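/- **Conventions.** Hilbert spaces are complex, operators are bounded and linear, and an inclusion $H\subseteq K$ of Hilbert spaces means a fixed isometric embedding. For an operator $A$ on $H$ (or from $H$ to $H'$) and $B$ on $K\supseteq H$ (or from $K$ to $K'\supseteq H'$), $A\subseteq B$ means $Ah=Bh$ for all $h\in H$; $|A|=(A^*A)^{1/2}$; $\ker A$ and $\mathcal R(A)$ are the kernel and the range. A closed subspace $M$ reduces $A$ if $AM\subseteq M$ and $A^*M\subseteq M$. An operator $S$ on $H$ is *subnormal* if $S\subseteq N$ for some normal operator $N$ on some Hilbert space $K\supseteq H$; $N$ is a *minimal normal extension* of $S$, written $N=\operatorname{mne}S$, if in addition $K$ is the only closed subspace of $K$ that contains $H$ and reduces $N$. If $N=\operatorname{mne}S$, $P$ is the orthogonal projection of $K$ onto $H$ and $A$ commutes with $S$ and $S^*$, then the *lift* of $A$ relative to $\{N\}'$ is the (unique) operator $B$ on $K$ that commutes with $N$ and $P$ and satisfies $A\subseteq B$. For nonzero Hilbert spaces $H_1,H_2$ we write $\begin{bmatrix}V&E\\0&X\end{bmatrix}\in\mathscr S_{H_1,H_2}$ (resp. $\in\mathscr N_{H_1,H_2}$)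 if $V^*V=I$, $V^*E=0$, $XE^*E=E^*EX$ and $X$ is subnormal (resp. normal), where $V$ acts on $H_1$, $X$ on $H_2$ and $E:H_2\to H_1$. A $2\times2$ block operator $[\tilde A_{ij}]$ on $K_1\oplus K_2$ is an *entrywise extension* of $[A_{ij}]$ on $H_1\oplus H_2$, written $[A_{ij}]\preceq[\tilde A_{ij}]$, if $H_j\subseteq K_j$ and $A_{ij}\subseteq\tilde A_{ij}$ for $i,j=1,2$. **Theorem 1.8.** Suppose that $\begin{bmatrix}\tilde V&\tilde E\\0&N\end{bmatrix}\in\mathscr N_{K_1,K_2}$ is an entrywise extension of $T=\begin{bmatrix}V&E\\0&S\end{bmatrix}\in\mathscr S_{H_1,H_2}$ such that $|E|\subseteq|\tilde E|$ and $N$ is a minimal normal extension of $S$. Set $H_{21}=\ker E$, $H_{22}=\overline{\mathcal R(|E|)}$ and $E_j=E|_{H_{2j}}:H_{2j}\to H_1$ for $j=1,2$. Then: (a) $H_{2j}$ reduces $S$ and $S_j:=S|_{H_{2j}}$ is subnormal for $j=1,2$; (b) $H_2=H_{21}\oplus H_{22}$ and $S=S_1\oplus S_2$; (c) $E(f_1\oplus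 f_2)=E_1f_1+E_2f_2$ for $f_j\in H_{2j}$, $E_1=0$ and $E_2$ is injective. Moreover, there is exactly one orthogonal decomposition $K_2=K_{21}\oplus K_{22}$ such that, for $j=1,2$, $K_{2j}$ reduces $N$, $H_{2j}\subseteq K_{2j}$ and $N_j:=N|_{K_{2j}}$ is a minimal normal extension of $S_j$. For this decomposition (so $N=N_1\oplus N_2$) let $\tilde E_j=\tilde E|_{K_{2j}}:K_{2j}\to K_1$. Then for $j=1,2$: (d) if $H_{2j}\neq\{0\}$, then $\begin{bmatrix}V&E_j\\0&S_j\end{bmatrix}\in\mathscr S_{H_1,H_{2j}}$ and $\begin{bmatrix}\tilde V&\tilde E_j\\0&N_j\end{bmatrix}\in\mathscr N_{K_1,K_{2j}}$; (e) $\begin{bmatrix}V&E_j\\0&S_j\end{bmatrix}\preceq\begin{bmatrix}\tilde V&\tilde E_j\\0&N_j\end{bmatrix}$; (f) $|\tilde E_j|$ is the lift of $|E_j|$ relative to $\{N_j\}'$ and $|\tilde E|$ is the lift of $|E|$ relative to $\{N\}'$; in particular $|E_j|\subseteq|\tilde E_j|$; (g) $\tilde E_1=0$ and $\tilde E_2$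 is injective. -/

import Mathlib

open ContinuousLinearMap

noncomputable section

namespace BrownianLift

/-! ### Basic notions on (complex) Hilbert spaces

An inclusion `H ⊆ K` of Hilbert spaces is an isometric embedding `ι : H →ₗᵢ[ℂ] K`. -/

section Basic

variable {H H' K K' : Type*}
  [NormedAddCommGroup H] [InnerProductSpace ℂ H]
  [NormedAddCommGroup H'] [InnerProductSpace ℂ H']
  [NormedAddCommGroup K] [InnerProductSpace ℂ K]
  [NormedAddCommGroup K'] [InnerProductSpace ℂ K']

/-- A closed subspace of a Hilbert space is a Hilbert space. -/
instance completeSpace_closedSubmodule [CompleteSpace H] (M : ClosedSubmodule ℂ H) :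
    CompleteSpace M.toSubmodule :=
  M.isClosed.completeSpace_coe

/-- The kernel of a bounded operator, as a closed subspace. -/
def closedKer (A : H →L[ℂ] K) : ClosedSubmodule ℂ H :=
  (⊥ : ClosedSubmodule ℂ K).comap A

/-- The closure of the range of a bounded operator, as a closed subspace. -/
def closedRange (A : H →L[ℂ] K) : ClosedSubmodule ℂ K :=
  (LinearMap.range (A : H →ₗ[ℂ] K)).closure

/-- `A ⊆ B`: the operator `B : K → K'` extends `A : H → H'`, where `H ⊆ K` via `ι` and
`H' ⊆ K'` via `ι'`. -/
def Extends (ι : H →ₗᵢ[ℂ] K) (ι' : H' →ₗᵢ[ℂ] K') (A : H →L[ℂ] H') (B : K →L[ℂ] K') : Prop :=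
  ∀ h : H, B (ι h) = ι' (A h)

/-- The modulus `|A| = (A* A)^{1/2}` of a bounded operator between Hilbert spaces. -/
def modulus [CompleteSpace H] [CompleteSpace K] (A : H →L[ℂ] K) : H →L[ℂ] H :=
  CFC.sqrt (adjoint A ∘L A)

/-- `M` reduces `A`: the closed subspace `M` is invariant for `A` and for `A*`. -/
structure Reduces [CompleteSpace H] (M : ClosedSubmodule ℂ H) (A : H →L[ℂ] H) : Prop where
  map_mem : ∀ x ∈ M, A x ∈ M
  adjoint_map_mem : ∀ x ∈ M, adjoint A x ∈ M

/-- The restriction `A|_M : M → M` of an operator to a reducing subspace. -/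
def Reduces.part [CompleteSpace H] {M : ClosedSubmodule ℂ H} {A : H →L[ℂ] H}
    (h : Reduces M A) : M.toSubmodule →L[ℂ] M.toSubmodule :=
  A.restrict (p := M.toSubmodule) (q := M.toSubmodule) h.map_mem

/-- The restriction `A|_M : M → K` of an operator `A : H → K` to a closed subspace. -/
def restrictTo (A : H →L[ℂ] K) (M : ClosedSubmodule ℂ H) : M.toSubmodule →L[ℂ] K :=
  A ∘L M.toSubmodule.subtypeL

/-- If `H ⊆ K` via `ι` and `ι` maps `M ⊆ H` into `L ⊆ K`, this is the resulting
inclusion `M ⊆ L`. -/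
def restrictEmbedding (ι : H →ₗᵢ[ℂ] K) (M : ClosedSubmodule ℂ H) (L : ClosedSubmodule ℂ K)
    (h : ∀ x ∈ M, ι x ∈ L) : M.toSubmodule →ₗᵢ[ℂ] L.toSubmodule where
  toLinearMap := ι.toLinearMap.restrict (p := M.toSubmodule) (q := L.toSubmodule) h
  norm_map' x := ι.norm_map x

/-- `H = M 0 ⊕ M 1`, orthogonal sum of two closed subspaces. -/
structure IsOrthogonalSum (M : Fin 2 → ClosedSubmodule ℂ H) : Prop where
  ortho : (M 0).toSubmodule ⟂ (M 1).toSubmodule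
  sup_eq_top : (M 0).toSubmodule ⊔ (M 1).toSubmodule = ⊤

end Basic

/-! ### Subnormal operators, minimal normal extensions, lifts -/

section Subnormal

/-- `N` is a normal extension of `S`. -/
structure IsNormalExtension {H K : Type*}
    [NormedAddCommGroup H] [InnerProductSpace ℂ H]
    [NormedAddCommGroup K] [InnerProductSpace ℂ K] [CompleteSpace K]
    (ι : H →ₗᵢ[ℂ] K) (S : H →L[ℂ] H) (N : K →L[ℂ] K) : Prop where
  normal : IsStarNormal N
  extend : Extends ι ι S N

/-- `S` is subnormal: it has a normal extension on some Hilbert space. -/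
def IsSubnormal.{u} {H : Type u} [NormedAddCommGroup H] [InnerProductSpace ℂ H]
    (S : H →L[ℂ] H) : Prop :=
  ∃ (K : Type u) (_ : NormedAddCommGroup K) (_ : InnerProductSpace ℂ K) (_ : CompleteSpace K)
    (ι : H →ₗᵢ[ℂ] K) (N : K →L[ℂ] K), IsNormalExtension ι S N

variable {H K : Type*}
  [NormedAddCommGroup H] [InnerProductSpace ℂ H] [CompleteSpace H]
  [NormedAddCommGroup K] [InnerProductSpace ℂ K] [CompleteSpace K]

/-- `N = mne S`: `N` is a normal extension of `S` and the only closed subspace of `K` that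
contains `H` and reduces `N` is `K`. -/
structure IsMinimalNormalExtension (ι : H →ₗᵢ[ℂ] K) (S : H →L[ℂ] H) (N : K →L[ℂ] K) : Prop
    extends IsNormalExtension ι S N where
  minimal : ∀ M : ClosedSubmodule ℂ K, (∀ h : H, ι h ∈ M) → Reduces M N → M = ⊤

/-- The orthogonal projection `P = ι ι*` of `K` onto the copy of `H` in `K`. -/
def projectionOnto (ι : H →ₗᵢ[ℂ] K) : K →L[ℂ] K :=
  ι.toContinuousLinearMap ∘L adjoint ι.toContinuousLinearMap

/-- For `N = mne S`: `A ∈ {S, S*}'` and `B` is the lift of `A` relative to `{N}'`, i.e.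
`B ∈ {N}' ∩ {P}'` and `A ⊆ B`. The commutant `𝓕'` is `Set.centralizer 𝓕`. -/
structure IsLift (ι : H →ₗᵢ[ℂ] K) (S : H →L[ℂ] H) (N : K →L[ℂ] K)
    (A : H →L[ℂ] H) (B : K →L[ℂ] K) : Prop where
  mem_commutant : A ∈ Set.centralizer {S, adjoint S}
  lift_mem : B ∈ Set.centralizer {N} ∩ Set.centralizer {projectionOnto ι}
  extend : Extends ι ι A B

end Subnormal

/-! ### Operators on `H₁ ⊕ H₂` and their `2 × 2` block matrices

`WithLp 2 (H₁ × H₂)` is the Hilbert space direct sum. -/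

section Block

variable {H₁ H₂ K₁ K₂ : Type*}
  [NormedAddCommGroup H₁] [InnerProductSpace ℂ H₁]
  [NormedAddCommGroup H₂] [InnerProductSpace ℂ H₂]
  [NormedAddCommGroup K₁] [InnerProductSpace ℂ K₁]
  [NormedAddCommGroup K₂] [InnerProductSpace ℂ K₂]

/-- The inclusion of the first summand. -/
def inlL (H₁ H₂ : Type*) [NormedAddCommGroup H₁] [InnerProductSpace ℂ H₁]
    [NormedAddCommGroup H₂] [InnerProductSpace ℂ H₂] : H₁ →L[ℂ] WithLp 2 (H₁ × H₂) :=
  (WithLp.prodContinuousLinearEquiv 2 ℂ H₁ H₂).symm.toContinuousLinearMap ∘L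
    ContinuousLinearMap.inl ℂ H₁ H₂

/-- The inclusion of the second summand. -/
def inrL (H₁ H₂ : Type*) [NormedAddCommGroup H₁] [InnerProductSpace ℂ H₁]
    [NormedAddCommGroup H₂] [InnerProductSpace ℂ H₂] : H₂ →L[ℂ] WithLp 2 (H₁ × H₂) :=
  (WithLp.prodContinuousLinearEquiv 2 ℂ H₁ H₂).symm.toContinuousLinearMap ∘L
    ContinuousLinearMap.inr ℂ H₁ H₂

/-- The operator `[A₁₁, A₁₂; A₂₁, A₂₂]` on `H₁ ⊕ H₂`. -/
def block (A₁₁ : H₁ →L[ℂ] H₁) (A₁₂ : H₂ →L[ℂ] H₁) (A₂₁ : H₁ →L[ℂ] H₂) (A₂₂ : H₂ →L[ℂ] H₂) :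
    WithLp 2 (H₁ × H₂) →L[ℂ] WithLp 2 (H₁ × H₂) :=
  inlL H₁ H₂ ∘L (A₁₁ ∘L WithLp.fstL 2 ℂ H₁ H₂ + A₁₂ ∘L WithLp.sndL 2 ℂ H₁ H₂) +
    inrL H₁ H₂ ∘L (A₂₁ ∘L WithLp.fstL 2 ℂ H₁ H₂ + A₂₂ ∘L WithLp.sndL 2 ℂ H₁ H₂)

/-- The `(1,1)` entry. -/
def entry₁₁ (T : WithLp 2 (H₁ × H₂) →L[ℂ] WithLp 2 (H₁ × H₂)) : H₁ →L[ℂ] H₁ :=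
  WithLp.fstL 2 ℂ H₁ H₂ ∘L T ∘L inlL H₁ H₂

/-- The `(1,2)` entry. -/
def entry₁₂ (T : WithLp 2 (H₁ × H₂) →L[ℂ] WithLp 2 (H₁ × H₂)) : H₂ →L[ℂ] H₁ :=
  WithLp.fstL 2 ℂ H₁ H₂ ∘L T ∘L inrL H₁ H₂

/-- The `(2,1)` entry. -/
def entry₂₁ (T : WithLp 2 (H₁ × H₂) →L[ℂ] WithLp 2 (H₁ × H₂)) : H₁ →L[ℂ] H₂ :=
  WithLp.sndL 2 ℂ H₁ H₂ ∘L T ∘L inlL H₁ H₂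

/-- The `(2,2)` entry. -/
def entry₂₂ (T : WithLp 2 (H₁ × H₂) →L[ℂ] WithLp 2 (H₁ × H₂)) : H₂ →L[ℂ] H₂ :=
  WithLp.sndL 2 ℂ H₁ H₂ ∘L T ∘L inrL H₁ H₂

section entries

variable (A₁₁ : H₁ →L[ℂ] H₁) (A₁₂ : H₂ →L[ℂ] H₁) (A₂₁ : H₁ →L[ℂ] H₂) (A₂₂ : H₂ →L[ℂ] H₂)

@[simp] theorem entry₁₁_block : entry₁₁ (block A₁₁ A₁₂ A₂₁ A₂₂) = A₁₁ := by
  ext x; simp [entry₁₁, block, inlL, inrL]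

@[simp] theorem entry₁₂_block : entry₁₂ (block A₁₁ A₁₂ A₂₁ A₂₂) = A₁₂ := by
  ext x; simp [entry₁₂, block, inlL, inrL]

@[simp] theorem entry₂₁_block : entry₂₁ (block A₁₁ A₁₂ A₂₁ A₂₂) = A₂₁ := by
  ext x; simp [entry₂₁, block, inlL, inrL]

@[simp] theorem entry₂₂_block : entry₂₂ (block A₁₁ A₁₂ A₂₁ A₂₂) = A₂₂ := by
  ext x; simp [entry₂₂, block, inlL, inrL]

end entries

/-- `R` on `K₁ ⊕ K₂` is an entrywise extension of `T` on `H₁ ⊕ H₂`, where `H₁ ⊆ K₁` via `ι₁`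
and `H₂ ⊆ K₂` via `ι₂`. -/
structure EntrywiseExtends (ι₁ : H₁ →ₗᵢ[ℂ] K₁) (ι₂ : H₂ →ₗᵢ[ℂ] K₂)
    (T : WithLp 2 (H₁ × H₂) →L[ℂ] WithLp 2 (H₁ × H₂))
    (R : WithLp 2 (K₁ × K₂) →L[ℂ] WithLp 2 (K₁ × K₂)) : Prop where
  ext₁₁ : Extends ι₁ ι₁ (entry₁₁ T) (entry₁₁ R)
  ext₁₂ : Extends ι₂ ι₁ (entry₁₂ T) (entry₁₂ R)
  ext₂₁ : Extends ι₁ ι₂ (entry₂₁ T) (entry₂₁ R)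
  ext₂₂ : Extends ι₂ ι₂ (entry₂₂ T) (entry₂₂ R)

variable [CompleteSpace H₁] [CompleteSpace H₂]

/-- `T` is a Brownian-type operator with respect to `H₁ ⊕ H₂`: both summands are nonzero,
`T = [V, E; 0, X]`, `V* V = I`, `V* E = 0` and `X E* E = E* E X`. -/
structure IsBrownianType (T : WithLp 2 (H₁ × H₂) →L[ℂ] WithLp 2 (H₁ × H₂)) : Prop where
  nontrivial₁ : Nontrivial H₁
  nontrivial₂ : Nontrivial H₂
  upper : entry₂₁ T = 0
  isometry : adjoint (entry₁₁ T) ∘L entry₁₁ T = ContinuousLinearMap.id ℂ H₁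
  ortho : adjoint (entry₁₁ T) ∘L entry₁₂ T = 0
  comm : entry₂₂ T ∘L (adjoint (entry₁₂ T) ∘L entry₁₂ T) =
    (adjoint (entry₁₂ T) ∘L entry₁₂ T) ∘L entry₂₂ T

/-- `T ∈ 𝒮_{H₁,H₂}`: Brownian-type with subnormal `(2,2)` entry. -/
structure IsClassS (T : WithLp 2 (H₁ × H₂) →L[ℂ] WithLp 2 (H₁ × H₂)) : Prop
    extends IsBrownianType T where
  subnormal : IsSubnormal (entry₂₂ T)

/-- `T ∈ 𝒩_{H₁,H₂}`: Brownian-type with normal `(2,2)` entry. -/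
structure IsClassN (T : WithLp 2 (H₁ × H₂) →L[ℂ] WithLp 2 (H₁ × H₂)) : Prop
    extends IsBrownianType T where
  normal : IsStarNormal (entry₂₂ T)

/-- `H₂₁ = ker E` (index `0`) and `H₂₂ = closure of the range of |E|` (index `1`). -/
def piece (E : H₂ →L[ℂ] H₁) : Fin 2 → ClosedSubmodule ℂ H₂
  | 0 => closedKer E
  | 1 => closedRange (modulus E)

end Block

/-- Let `S = S₀ ⊕ S₁` with `S_j = S|_{M j}`, and `H ⊆ K` via `ι`. The family `L` is an orthogonal
decomposition `K = L 0 ⊕ L 1` with `N = N₀ ⊕ N₁`, where `N_j = N|_{L j}`, such that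
`M j ⊆ L j` and `N_j = mne S_j`. -/
structure IsMneDecomposition {H K : Type*}
    [NormedAddCommGroup H] [InnerProductSpace ℂ H] [CompleteSpace H]
    [NormedAddCommGroup K] [InnerProductSpace ℂ K] [CompleteSpace K]
    (ι : H →ₗᵢ[ℂ] K) {S : H →L[ℂ] H} (N : K →L[ℂ] K) {M : Fin 2 → ClosedSubmodule ℂ H}
    (hM : ∀ j, Reduces (M j) S) (L : Fin 2 → ClosedSubmodule ℂ K) : Prop where
  sum : IsOrthogonalSum L
  reduces : ∀ j, Reduces (L j) N
  incl : ∀ j, ∀ x ∈ M j, ι x ∈ L j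
  mne : ∀ j, IsMinimalNormalExtension (restrictEmbedding ι (M j) (L j) (incl j))
    (hM j).part (reduces j).part

end BrownianLift

end

open BrownianLift

/-! `E* E` is self-adjoint and commutes with `S`, so its square root `|E|` commutes with `S` and
`S*`. Hence `ker E = ker |E|` reduces `S`, with orthocomplement the closed range of `|E|`. The same
holds for `E'` and `N`.

The required decomposition of `K₂` is `piece E'`. Since `E'` extends `E`, kernel goes into kernel;
since `|E'|` extends `|E|`, closed range goes into closed range. So the embedding respects both
orthogonal splittings, and minimality of `N` passes to its parts (`IsMinimalNormalExtension.part`).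
Each summand is the least `N`-reducing subspace containing its piece of `H₂`, which gives
uniqueness.

The remaining clauses are then checked for `piece E'` alone, using that the modulus of a restriction
is the part of the modulus (`modulus_restrictTo`). -/

namespace BrownianLift

/-! ### Underlying vectors of restrictions -/

section Restriction

variable {H K : Type*}
  [NormedAddCommGroup H] [InnerProductSpace ℂ H]
  [NormedAddCommGroup K] [InnerProductSpace ℂ K]

@[simp] theorem restrictTo_apply (A : H →L[ℂ] K) (M : ClosedSubmodule ℂ H) (x : M.toSubmodule) :
    restrictTo A M x = A x := rfl

@[simp] theorem coe_restrictEmbedding (ι : H →ₗᵢ[ℂ] K) (M : ClosedSubmodule ℂ H)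
    (L : ClosedSubmodule ℂ K) (h : ∀ x ∈ M, ι x ∈ L) (x : M.toSubmodule) :
    (restrictEmbedding ι M L h x : K) = ι x := rfl

end Restriction

/-! ### Reducing subspaces and minimal normal extensions -/

section Reducing

variable {H K : Type*}
  [NormedAddCommGroup H] [InnerProductSpace ℂ H] [CompleteSpace H]
  [NormedAddCommGroup K] [InnerProductSpace ℂ K] [CompleteSpace K]

@[simp] theorem Reduces.coe_part {M : ClosedSubmodule ℂ H} {A : H →L[ℂ] H} (h : Reduces M A)
    (x : M.toSubmodule) : (h.part x : H) = A x := rfl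

theorem Reduces.adjoint {M : ClosedSubmodule ℂ H} {A : H →L[ℂ] H} (h : Reduces M A) :
    Reduces M (ContinuousLinearMap.adjoint A) :=
  ⟨h.adjoint_map_mem, by simpa using h.map_mem⟩

theorem Reduces.adjoint_part {M : ClosedSubmodule ℂ H} {A : H →L[ℂ] H} (h : Reduces M A) :
    ContinuousLinearMap.adjoint h.part = h.adjoint.part := by
  symm
  rw [ContinuousLinearMap.eq_adjoint_iff]
  intro x y
  simp [ContinuousLinearMap.adjoint_inner_left]

theorem Reduces.map_mem_orthogonal {M : ClosedSubmodule ℂ H} {A : H →L[ℂ] H} (h : Reduces M A)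
    {x : H} (hx : x ∈ M.toSubmoduleᗮ) : A x ∈ M.toSubmoduleᗮ := by
  intro y hy
  rw [← ContinuousLinearMap.adjoint_inner_left]
  exact hx _ (h.adjoint_map_mem y hy)

theorem Reduces.of_orthogonal {M M' : ClosedSubmodule ℂ H} {A : H →L[ℂ] H} (h : Reduces M A)
    (hM' : M'.toSubmodule = M.toSubmoduleᗮ) : Reduces M' A := by
  refine ⟨fun x hx => ?_, fun x hx => ?_⟩ <;>
    rw [← ClosedSubmodule.mem_toSubmodule_iff, hM'] at hx ⊢
  · exact h.map_mem_orthogonal hx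
  · exact h.adjoint.map_mem_orthogonal hx

theorem Reduces.orthogonalProjection_apply {M : ClosedSubmodule ℂ H} {A : H →L[ℂ] H}
    (h : Reduces M A) (x : H) :
    M.toSubmodule.orthogonalProjectionOnto (A x) = h.part (M.toSubmodule.orthogonalProjectionOnto x) := by
  have hx : A x = (h.part (M.toSubmodule.orthogonalProjectionOnto x) : H) +
      A (x - M.toSubmodule.starProjection x) := by
    simp
  rw [hx, map_add, Submodule.orthogonalProjectionOnto_mem_subspace_eq_self,
    Submodule.orthogonalProjectionOnto_apply_of_mem_orthogonal (h.map_mem_orthogonal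
      (Submodule.sub_starProjection_mem_orthogonal x)), add_zero]

theorem Reduces.isStarNormal_part {M : ClosedSubmodule ℂ H} {A : H →L[ℂ] H} (h : Reduces M A)
    (hA : IsStarNormal A) : IsStarNormal h.part := by
  refine ⟨?_⟩
  rw [ContinuousLinearMap.star_eq_adjoint, h.adjoint_part]
  ext x
  exact DFunLike.congr_fun hA.star_comm_self.eq (x : H)

/-- A minimal normal extension restricts to minimal normal extensions of the summands. -/
theorem IsMinimalNormalExtension.part {ι : H →ₗᵢ[ℂ] K} {S : H →L[ℂ] H} {N : K →L[ℂ] K}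
    (hN : IsMinimalNormalExtension ι S N) {M : ClosedSubmodule ℂ H} {L : ClosedSubmodule ℂ K}
    (hM : Reduces M S) (hL : Reduces L N) (hi : ∀ x ∈ M, ι x ∈ L)
    (ho : ∀ x ∈ M.toSubmoduleᗮ, ι x ∈ L.toSubmoduleᗮ) :
    IsMinimalNormalExtension (restrictEmbedding ι M L hi) hM.part hL.part := by
  refine ⟨⟨hL.isStarNormal_part hN.normal, fun x => Subtype.ext (hN.extend x)⟩, ?_⟩
  intro R hR hred
  -- This preimage is `R ⊕ Lᗮ`. It reduces `N`, and it contains `H` because `ι` maps `M` into `L`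
  -- and `Mᗮ` into `Lᗮ`; minimality of `N` applies to it.
  have htop : R.comap L.toSubmodule.orthogonalProjectionOnto = ⊤ := by
    refine hN.minimal _ (fun h => ?_) ⟨fun x hx => ?_, fun x hx => ?_⟩
    · rw [ClosedSubmodule.mem_comap]
      have hh : ι h = (restrictEmbedding ι M L hi (M.toSubmodule.orthogonalProjectionOnto h) : K) +
          ι (h - M.toSubmodule.starProjection h) := by
        simp
      rw [hh, map_add, Submodule.orthogonalProjectionOnto_mem_subspace_eq_self,
        Submodule.orthogonalProjectionOnto_apply_of_mem_orthogonal
          (ho _ (Submodule.sub_starProjection_mem_orthogonal h)), add_zero]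
      exact hR _
    · rw [ClosedSubmodule.mem_comap] at hx ⊢
      rw [hL.orthogonalProjection_apply]
      exact hred.map_mem _ hx
    · rw [ClosedSubmodule.mem_comap] at hx ⊢
      rw [hL.adjoint.orthogonalProjection_apply, ← hL.adjoint_part]
      exact hred.adjoint_map_mem _ hx
  refine eq_top_iff.2 fun x _ => ?_
  have hx : (x : K) ∈ R.comap L.toSubmodule.orthogonalProjectionOnto := htop ▸ ClosedSubmodule.mem_top
  rwa [ClosedSubmodule.mem_comap, Submodule.orthogonalProjectionOnto_mem_subspace_eq_self] at hx

/-- If `N|_L` is minimal over `M ⊆ L`, then `L` lies in every reducing subspace containing `M`. -/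
theorem IsMinimalNormalExtension.le_of_reduces {ι : H →ₗᵢ[ℂ] K} {S : H →L[ℂ] H} {N : K →L[ℂ] K}
    {M : ClosedSubmodule ℂ H} {L L' : ClosedSubmodule ℂ K}
    {hM : Reduces M S} {hL : Reduces L N} {hi : ∀ x ∈ M, ι x ∈ L}
    (hmne : IsMinimalNormalExtension (restrictEmbedding ι M L hi) hM.part hL.part)
    (hL' : Reduces L' N) (hi' : ∀ x ∈ M, ι x ∈ L') : L ≤ L' := by
  -- `L ∩ L'`, seen inside `L`, contains `M` and reduces `N|_L`.
  have htop : L'.comap L.toSubmodule.subtypeL = ⊤ := by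
    refine hmne.minimal _ (fun h => hi' _ h.2) ⟨fun x hx => hL'.map_mem _ hx, fun x hx => ?_⟩
    rw [hL.adjoint_part]
    exact hL'.adjoint_map_mem _ hx
  intro x hx
  have : (⟨x, hx⟩ : L.toSubmodule) ∈ L'.comap L.toSubmodule.subtypeL :=
    htop ▸ ClosedSubmodule.mem_top
  exact this

/-- Both `L j` and `L' j` are least among the `N`-reducing subspaces containing the image of `M j`.
-/
theorem IsMneDecomposition.unique {ι : H →ₗᵢ[ℂ] K} {S : H →L[ℂ] H} {N : K →L[ℂ] K}
    {M : Fin 2 → ClosedSubmodule ℂ H} {hM : ∀ j, Reduces (M j) S}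
    {L L' : Fin 2 → ClosedSubmodule ℂ K}
    (hL : IsMneDecomposition ι N hM L) (hL' : IsMneDecomposition ι N hM L') : L = L' :=
  funext fun j => le_antisymm ((hL.mne j).le_of_reduces (hL'.reduces j) (hL'.incl j))
    ((hL'.mne j).le_of_reduces (hL.reduces j) (hL.incl j))

theorem IsSubnormal.part {S : H →L[ℂ] H} (hS : IsSubnormal S) {M : ClosedSubmodule ℂ H}
    (hM : Reduces M S) : IsSubnormal hM.part := by
  obtain ⟨L, _, _, _, ι, N, hN⟩ := hS
  exact ⟨L, _, _, ‹_›, ι.comp M.toSubmodule.subtypeₗᵢ, N, hN.normal, fun x => hN.extend x⟩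

/-- A self-adjoint extension of an operator on `H` commutes with the projection onto `H`. -/
theorem commute_projectionOnto {ι : H →ₗᵢ[ℂ] K} {A : H →L[ℂ] H} {B : K →L[ℂ] K}
    (hA : IsSelfAdjoint A) (hB : IsSelfAdjoint B) (h : Extends ι ι A B) :
    Commute (projectionOnto ι) B := by
  have h₁ : B ∘L ι.toContinuousLinearMap = ι.toContinuousLinearMap ∘L A := by
    ext x; exact h x
  -- The adjoint of the intertwining relation `h₁`.
  have h₂ : ContinuousLinearMap.adjoint ι.toContinuousLinearMap ∘L B =
      A ∘L ContinuousLinearMap.adjoint ι.toContinuousLinearMap := by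
    have := congrArg ContinuousLinearMap.adjoint h₁
    rwa [ContinuousLinearMap.adjoint_comp, ContinuousLinearMap.adjoint_comp,
      hA.adjoint_eq, hB.adjoint_eq] at this
  change (ι.toContinuousLinearMap ∘L _) ∘L B = B ∘L (ι.toContinuousLinearMap ∘L _)
  rw [ContinuousLinearMap.comp_assoc, h₂, ← ContinuousLinearMap.comp_assoc,
    ← ContinuousLinearMap.comp_assoc, h₁]

end Reducing

/-! ### The modulus and the splitting into kernel and closed range -/

section Modulus

variable {H K : Type*}
  [NormedAddCommGroup H] [InnerProductSpace ℂ H] [CompleteSpace H]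
  [NormedAddCommGroup K] [InnerProductSpace ℂ K] [CompleteSpace K]

theorem modulus_nonneg (A : H →L[ℂ] K) : 0 ≤ modulus A := CFC.sqrt_nonneg _

theorem isSelfAdjoint_modulus (A : H →L[ℂ] K) : IsSelfAdjoint (modulus A) :=
  (modulus_nonneg A).isSelfAdjoint

theorem modulus_mul_self (A : H →L[ℂ] K) : modulus A * modulus A = adjoint A ∘L A :=
  CFC.sqrt_mul_sqrt_self _ ((nonneg_iff_isPositive _).2 (isPositive_adjoint_comp_self A))

theorem norm_modulus_apply (A : H →L[ℂ] K) (x : H) : ‖modulus A x‖ = ‖A x‖ := by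
  have h : inner ℂ (modulus A x) (modulus A x) = inner ℂ (A x) (A x) := by
    rw [← adjoint_inner_left, (isSelfAdjoint_modulus A).adjoint_eq, ← mul_apply_eq_comp,
      modulus_mul_self, coe_comp, Function.comp_apply, adjoint_inner_left]
  rw [inner_self_eq_norm_sq_to_K, inner_self_eq_norm_sq_to_K] at h
  exact (sq_eq_sq₀ (norm_nonneg _) (norm_nonneg _)).1 (by exact_mod_cast h)

theorem modulus_apply_eq_zero {A : H →L[ℂ] K} {x : H} : modulus A x = 0 ↔ A x = 0 := by
  rw [← norm_eq_zero, norm_modulus_apply, norm_eq_zero]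

theorem commute_modulus {A : H →L[ℂ] K} {S : H →L[ℂ] H} (h : Commute (adjoint A ∘L A) S) :
    Commute (modulus A) S := by
  -- The square root is a continuous function of `A* A`, and commutation with `A* A` passes to its
  -- functional calculus.
  exact h.cfcₙ_nnreal _

/-- Taking stars suffices, since `|A|` is self-adjoint. -/
theorem commute_adjoint_modulus {A : H →L[ℂ] K} {S : H →L[ℂ] H}
    (h : Commute (adjoint A ∘L A) S) : Commute (modulus A) (adjoint S) := by
  simpa [(isSelfAdjoint_modulus A).star_eq, star_eq_adjoint] using (commute_modulus h).star_star

theorem mem_piece_zero {A : H →L[ℂ] K} {x : H} : x ∈ piece A 0 ↔ A x = 0 := Iff.rfl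

/-- `ker A = ker |A|`, and the orthocomplement of the kernel of a self-adjoint operator is its
closed range. -/
theorem piece_one_toSubmodule (A : H →L[ℂ] K) :
    (piece A 1).toSubmodule = (piece A 0).toSubmoduleᗮ := by
  have hker : (piece A 0).toSubmodule = (modulus A).ker := by
    ext x
    exact modulus_apply_eq_zero.symm
  rw [hker, orthogonal_ker, (isSelfAdjoint_modulus A).adjoint_eq]
  rfl

theorem orthogonal_piece_zero (A : H →L[ℂ] K) :
    (piece A 0).toSubmoduleᗮ = (piece A 1).toSubmodule := (piece_one_toSubmodule A).symm

theorem orthogonal_piece_one (A : H →L[ℂ] K) :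
    (piece A 1).toSubmoduleᗮ = (piece A 0).toSubmodule := by
  rw [piece_one_toSubmodule, Submodule.orthogonal_orthogonal]

theorem isOrthogonalSum_piece (A : H →L[ℂ] K) : IsOrthogonalSum (piece A) := by
  refine ⟨?_, ?_⟩ <;> rw [piece_one_toSubmodule]
  · exact Submodule.isOrtho_orthogonal_right _
  · exact Submodule.sup_orthogonal_of_hasOrthogonalProjection

theorem injective_restrictTo_piece_one (A : H →L[ℂ] K) :
    Function.Injective (restrictTo A (piece A 1)) := by
  rw [injective_iff_map_eq_zero]
  intro x hx
  have h₁ : (x : H) ∈ (piece A 0).toSubmoduleᗮ := piece_one_toSubmodule A ▸ x.2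
  exact Subtype.ext (inner_self_eq_zero.1 (h₁ x (mem_piece_zero.2 hx)))

/-- The kernel of `|A|` is invariant under everything commuting with `|A|`, here `S` and `S*`; the
other piece is its orthocomplement. -/
theorem reduces_piece {A : H →L[ℂ] K} {S : H →L[ℂ] H} (h : Commute (adjoint A ∘L A) S)
    (j : Fin 2) : Reduces (piece A j) S := by
  have h₀ : Reduces (piece A 0) S := by
    refine ⟨fun x hx => ?_, fun x hx => ?_⟩ <;>
      rw [mem_piece_zero, ← modulus_apply_eq_zero] at hx ⊢
    · have := DFunLike.congr_fun (commute_modulus h).eq x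
      simpa [hx] using this
    · have := DFunLike.congr_fun (commute_adjoint_modulus h).eq x
      simpa [hx] using this
  fin_cases j
  · exact h₀
  · exact h₀.of_orthogonal (piece_one_toSubmodule A)

theorem reduces_piece_modulus (A : H →L[ℂ] K) (j : Fin 2) : Reduces (piece A j) (modulus A) :=
  reduces_piece (modulus_mul_self A ▸ (Commute.refl (modulus A)).mul_left (Commute.refl _)) j

/-- The part of `|A|` on `M` is positive and squares to `(A|_M)* (A|_M)`; positive square roots are
unique. -/
theorem modulus_restrictTo {A : H →L[ℂ] K} {M : ClosedSubmodule ℂ H}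
    (h : Reduces M (modulus A)) : modulus (restrictTo A M) = h.part := by
  refine CFC.sqrt_unique ?_ ?_
  · refine ContinuousLinearMap.ext fun x => ext_inner_right ℂ fun y => ?_
    rw [coe_comp, Function.comp_apply, adjoint_inner_left]
    have hx := DFunLike.congr_fun (modulus_mul_self A) (x : H)
    change inner ℂ (modulus A (modulus A x)) (y : H) = inner ℂ (A x) (A y)
    rw [← mul_apply_eq_comp, hx, coe_comp, Function.comp_apply, adjoint_inner_left]
  · have hA := (nonneg_iff_isPositive _).1 (modulus_nonneg A)
    rw [nonneg_iff_isPositive, isPositive_def']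
    refine ⟨?_, fun x => hA.re_inner_nonneg_left x⟩
    rw [isSelfAdjoint_iff', h.adjoint_part]
    ext x
    exact DFunLike.congr_fun hA.isSelfAdjoint.adjoint_eq (x : H)

theorem commute_restrictTo {A : H →L[ℂ] K} {S : H →L[ℂ] H} (h : Commute (adjoint A ∘L A) S)
    {M : ClosedSubmodule ℂ H} (hM : Reduces M S) (hA : Reduces M (modulus A)) :
    Commute (adjoint (restrictTo A M) ∘L restrictTo A M) hM.part := by
  rw [← modulus_mul_self, modulus_restrictTo hA]
  have hc : Commute hA.part hM.part := by
    ext x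
    exact DFunLike.congr_fun (commute_modulus h).eq (x : H)
  exact hc.mul_left hc

theorem isLift_modulus {H' K' : Type*}
    [NormedAddCommGroup H'] [InnerProductSpace ℂ H'] [CompleteSpace H']
    [NormedAddCommGroup K'] [InnerProductSpace ℂ K'] [CompleteSpace K']
    {ι : H →ₗᵢ[ℂ] K} {S : H →L[ℂ] H} {N : K →L[ℂ] K} {E : H →L[ℂ] H'} {E' : K →L[ℂ] K'}
    (hS : Commute (adjoint E ∘L E) S) (hN : Commute (adjoint E' ∘L E') N)
    (h : Extends ι ι (modulus E) (modulus E')) :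
    IsLift ι S N (modulus E) (modulus E') := by
  refine ⟨?_, ⟨?_, ?_⟩, h⟩
  · rintro m (rfl | rfl)
    · exact (commute_modulus hS).eq.symm
    · exact (commute_adjoint_modulus hS).eq.symm
  · rintro m rfl
    exact (commute_modulus hN).eq.symm
  · rintro m rfl
    exact commute_projectionOnto (isSelfAdjoint_modulus E) (isSelfAdjoint_modulus E') h

/-! ### Compatibility of the embedding with the two splittings -/

variable {H' K' : Type*}
  [NormedAddCommGroup H'] [InnerProductSpace ℂ H'] [CompleteSpace H']
  [NormedAddCommGroup K'] [InnerProductSpace ℂ K'] [CompleteSpace K']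
  {ι : H →ₗᵢ[ℂ] K} {ι' : H' →ₗᵢ[ℂ] K'} {E : H →L[ℂ] H'} {E' : K →L[ℂ] K'}

theorem map_mem_piece (hE : Extends ι ι' E E') (hmod : Extends ι ι (modulus E) (modulus E'))
    (j : Fin 2) (x : H) (hx : x ∈ piece E j) : ι x ∈ piece E' j := by
  fin_cases j
  · change E' (ι x) = 0
    rw [hE, mem_piece_zero.1 hx, map_zero]
  · have hle : piece E 1 ≤ (piece E' 1).comap ι.toContinuousLinearMap := by
      refine Submodule.closure_le.2 ?_
      rintro _ ⟨y, rfl⟩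
      change ι (modulus E y) ∈ (modulus E').range.topologicalClosure
      rw [← hmod y]
      exact Submodule.le_topologicalClosure _ ⟨_, rfl⟩
    exact hle hx

/-- The orthocomplement of one piece is the other piece, upstairs and downstairs, so `map_mem_piece`
applies with the indices swapped. -/
theorem map_mem_orthogonal_piece (hE : Extends ι ι' E E')
    (hmod : Extends ι ι (modulus E) (modulus E'))
    (j : Fin 2) (x : H) (hx : x ∈ (piece E j).toSubmoduleᗮ) :
    ι x ∈ (piece E' j).toSubmoduleᗮ := by
  fin_cases j
  · change x ∈ (piece E 0).toSubmoduleᗮ at hx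
    change ι x ∈ (piece E' 0).toSubmoduleᗮ
    rw [orthogonal_piece_zero] at hx ⊢
    exact map_mem_piece hE hmod 1 x hx
  · change x ∈ (piece E 1).toSubmoduleᗮ at hx
    change ι x ∈ (piece E' 1).toSubmoduleᗮ
    rw [orthogonal_piece_one] at hx ⊢
    exact map_mem_piece hE hmod 0 x hx

theorem isMneDecomposition_piece {S : H →L[ℂ] H} {N : K →L[ℂ] K}
    (hE : Extends ι ι' E E') (hmod : Extends ι ι (modulus E) (modulus E'))
    (hred : ∀ j, Reduces (piece E j) S) (hNE : Commute (adjoint E' ∘L E') N)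
    (hN : IsMinimalNormalExtension ι S N) : IsMneDecomposition ι N hred (piece E') where
  sum := isOrthogonalSum_piece E'
  reduces := reduces_piece hNE
  incl := map_mem_piece hE hmod
  mne j := hN.part (hred j) (reduces_piece hNE j) (map_mem_piece hE hmod j)
    (map_mem_orthogonal_piece hE hmod j)

theorem extends_modulus_restrictTo_piece (hmod : Extends ι ι (modulus E) (modulus E')) (j : Fin 2)
    (hi : ∀ x ∈ piece E j, ι x ∈ piece E' j) :
    Extends (restrictEmbedding ι (piece E j) (piece E' j) hi)
      (restrictEmbedding ι (piece E j) (piece E' j) hi)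
      (modulus (restrictTo E (piece E j))) (modulus (restrictTo E' (piece E' j))) := by
  intro x
  rw [modulus_restrictTo (reduces_piece_modulus E j),
    modulus_restrictTo (reduces_piece_modulus E' j)]
  exact Subtype.ext (hmod x)

end Modulus

/-! ### Brownian-type blocks and the theorem -/

/-- Brownian type passes to the restriction of the second column to a reducing subspace. -/
theorem IsBrownianType.restrictTo {H₁ H₂ : Type*}
    [NormedAddCommGroup H₁] [InnerProductSpace ℂ H₁] [CompleteSpace H₁]
    [NormedAddCommGroup H₂] [InnerProductSpace ℂ H₂] [CompleteSpace H₂]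
    {V : H₁ →L[ℂ] H₁} {E : H₂ →L[ℂ] H₁} {S : H₂ →L[ℂ] H₂} (h : IsBrownianType (block V E 0 S))
    {M : ClosedSubmodule ℂ H₂} (hM : Reduces M S) (hE : Reduces M (modulus E))
    (hne : Nontrivial M.toSubmodule) :
    IsBrownianType (block V (BrownianLift.restrictTo E M) 0 hM.part) where
  nontrivial₁ := h.nontrivial₁
  nontrivial₂ := hne
  upper := entry₂₁_block ..
  isometry := by simpa using h.isometry
  ortho := by
    have := h.ortho
    rw [entry₁₁_block, entry₁₂_block] at this ⊢
    ext x
    exact DFunLike.congr_fun this (x : H₂)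
  comm := by
    have hc := h.comm
    rw [entry₂₂_block, entry₁₂_block] at hc ⊢
    exact (commute_restrictTo (show Commute _ _ from hc.symm) hM hE).eq.symm

end BrownianLift

theorem theorem1p8 {H₁ H₂ K₁ K₂ : Type*}
    [NormedAddCommGroup H₁] [InnerProductSpace ℂ H₁] [CompleteSpace H₁]
    [NormedAddCommGroup H₂] [InnerProductSpace ℂ H₂] [CompleteSpace H₂]
    [NormedAddCommGroup K₁] [InnerProductSpace ℂ K₁] [CompleteSpace K₁]
    [NormedAddCommGroup K₂] [InnerProductSpace ℂ K₂] [CompleteSpace K₂]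
    (ι₁ : H₁ →ₗᵢ[ℂ] K₁) (ι₂ : H₂ →ₗᵢ[ℂ] K₂)
    (V : H₁ →L[ℂ] H₁) (E : H₂ →L[ℂ] H₁) (S : H₂ →L[ℂ] H₂)
    (V' : K₁ →L[ℂ] K₁) (E' : K₂ →L[ℂ] K₁) (N : K₂ →L[ℂ] K₂)
    (hT : IsClassS (block V E 0 S))
    (hR : IsClassN (block V' E' 0 N))
    (hext : EntrywiseExtends ι₁ ι₂ (block V E 0 S) (block V' E' 0 N))
    (hmod : Extends ι₂ ι₂ (modulus E) (modulus E'))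
    (hN : IsMinimalNormalExtension ι₂ S N) :
    -- (a), with `hred j` giving `S_j = (hred j).part`
    ∃ hred : ∀ j, Reduces (piece E j) S,
      (∀ j, IsSubnormal (hred j).part) ∧
      -- (b)
      IsOrthogonalSum (piece E) ∧
      (∀ (f₁ : (piece E 0).toSubmodule) (f₂ : (piece E 1).toSubmodule),
        S ((f₁ : H₂) + (f₂ : H₂)) = ((hred 0).part f₁ : H₂) + ((hred 1).part f₂ : H₂)) ∧
      -- (c)
      (∀ (f₁ : (piece E 0).toSubmodule) (f₂ : (piece E 1).toSubmodule),
        E ((f₁ : H₂) + (f₂ : H₂)) =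
          restrictTo E (piece E 0) f₁ + restrictTo E (piece E 1) f₂) ∧
      restrictTo E (piece E 0) = 0 ∧
      Function.Injective (restrictTo E (piece E 1)) ∧
      -- the decomposition `N = N₁ ⊕ N₂` with `N_j = mne S_j` exists and is unique
      (∃! L : Fin 2 → ClosedSubmodule ℂ K₂, IsMneDecomposition ι₂ N hred L) ∧
      ∀ (L : Fin 2 → ClosedSubmodule ℂ K₂) (hL : IsMneDecomposition ι₂ N hred L),
        -- (d), for nonzero summands, as membership in the classes requires
        (∀ j, Nontrivial (piece E j).toSubmodule →
          IsClassS (block V (restrictTo E (piece E j)) 0 (hred j).part) ∧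
          IsClassN (block V' (restrictTo E' (L j)) 0 (hL.reduces j).part)) ∧
        -- (e)
        (∀ j, EntrywiseExtends ι₁ (restrictEmbedding ι₂ (piece E j) (L j) (hL.incl j))
          (block V (restrictTo E (piece E j)) 0 (hred j).part)
          (block V' (restrictTo E' (L j)) 0 (hL.reduces j).part)) ∧
        -- (f)
        (∀ j, IsLift (restrictEmbedding ι₂ (piece E j) (L j) (hL.incl j))
          (hred j).part (hL.reduces j).part
          (modulus (restrictTo E (piece E j))) (modulus (restrictTo E' (L j)))) ∧
        IsLift ι₂ S N (modulus E) (modulus E') ∧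
        (∀ j, Extends (restrictEmbedding ι₂ (piece E j) (L j) (hL.incl j))
          (restrictEmbedding ι₂ (piece E j) (L j) (hL.incl j))
          (modulus (restrictTo E (piece E j))) (modulus (restrictTo E' (L j)))) ∧
        -- (g)
        restrictTo E' (L 0) = 0 ∧
        Function.Injective (restrictTo E' (L 1)) := by
  have hSE : Commute (adjoint E ∘L E) S := by
    have := hT.comm
    rw [entry₂₂_block, entry₁₂_block] at this
    exact this.symm
  have hNE : Commute (adjoint E' ∘L E') N := by
    have := hR.comm
    rw [entry₂₂_block, entry₁₂_block] at this
    exact this.symm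
  have hE : Extends ι₂ ι₁ E E' := by simpa using hext.ext₁₂
  have hV : Extends ι₁ ι₁ V V' := by simpa using hext.ext₁₁
  have hS : IsSubnormal S := by simpa using hT.subnormal
  have hred := reduces_piece hSE
  have hdec := isMneDecomposition_piece hE hmod hred hNE hN
  refine ⟨hred, fun j => hS.part (hred j), isOrthogonalSum_piece E, fun f₁ f₂ => by simp,
    fun f₁ f₂ => by simp, ContinuousLinearMap.ext fun x => x.2,
    injective_restrictTo_piece_one E, ⟨_, hdec, fun L hL => hL.unique hdec⟩, ?_⟩
  intro L hL
  -- Uniqueness reduces every clause about an arbitrary `L` to the explicit decomposition.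
  obtain rfl : L = piece E' := hL.unique hdec
  refine ⟨fun j hj => ⟨⟨hT.restrictTo (hred j) (reduces_piece_modulus E j) hj, ?_⟩,
      ⟨hR.restrictTo (hL.reduces j) (reduces_piece_modulus E' j) ?_, ?_⟩⟩,
    fun j => ⟨?_, ?_, ?_, ?_⟩,
    fun j => isLift_modulus (commute_restrictTo hSE (hred j) (reduces_piece_modulus E j))
      (commute_restrictTo hNE (hL.reduces j) (reduces_piece_modulus E' j))
      (extends_modulus_restrictTo_piece hmod j (hL.incl j)),
    isLift_modulus hSE hNE hmod,
    fun j => extends_modulus_restrictTo_piece hmod j (hL.incl j),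
    ContinuousLinearMap.ext fun x => x.2, injective_restrictTo_piece_one E'⟩
  · rw [entry₂₂_block]
    exact hS.part (hred j)
  · exact (restrictEmbedding ι₂ (piece E j) (piece E' j) (hL.incl j)).injective.nontrivial
  · rw [entry₂₂_block]
    exact (hL.reduces j).isStarNormal_part hN.normal
  · rwa [entry₁₁_block, entry₁₁_block]
  · rw [entry₁₂_block, entry₁₂_block]
    exact fun x => hE x
  · rw [entry₂₁_block, entry₂₁_block]
    exact fun x => by simp
  · rw [entry₂₂_block, entry₂₂_block]
    exact (hL.mne j).extend
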